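/- Let $G=(G_0,G_1,d,r,u,i,m)$ be an open localic groupoid (a groupoid internal to the category $\mathbf{Loc}$ of locales whose domain map $d$ is open). A (left) $G$-locale is a locale $X$ with an anchor map $p:X\to G_0$ and an associative, unital action $a:G_1\times_{G_0}X\to X$, where $G_1\times_{G_0}X$ is the pullback of $r$ and $p$, and $p\circ a=d\circ\pi_1$. A principal $G$-bundle over a locale $M$ is a $G$-locale $X$ with an open surjection $\pi:X\to M$ such that $\pi\circ a=\pi\circ\pi_2$ and the pairing map $\langle a,\pi_2\rangle:G_1\times_{G_0}X\to X\times_M X$ is an isomorphism. An equivariant map is a map of locales that commutes with the anchor maps and with the actions; an isomorphism of principal $G$-bundles over $M$ is an equivariant isomorphism of locales that commutes with the projections to $M$. **Lemma.** Let $X$ be a principal $G$-bundle over $M$ with projection $\pi$, and let $f:M'\to M$ be a map of locales. Then there is a principal $G$-bundle $\overline X$ over $M'$, with projection $\overline\pi:\overline X\to M'$, together with an equivariant map $\overline f:\overline X\to X$, such that the square $\pi\circ\overline f=f\circ\overline\pi$ commutes and is a pullback in $\mathbf{Loc}$ (so that $\overline X\cong X\times_M M'$). Moreover, for every principal $G$-bundle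 $X'$ over $M'$ with projection $\pi'$, and every equivariant map $f':X'\to X$ with $\pi\circ f'=f\circ\pi'$, there is a unique isomorphism $\varphi:X'\to\overline X$ of principal $G$-bundles over $M'$ with $\overline f\circ\varphi=f'$. -/

import Mathlib

open CategoryTheory CategoryTheory.Limits

universe u v

/-! ### Pullbacks of locales

Mathlib does not know that `Locale` has pullbacks.  We construct pushouts of frames. -/

namespace FrmPushout

section Construction

variable {A B C D : Type u} [Order.Frame A] [Order.Frame B] [Order.Frame C] [Order.Frame D]

/-- The lower sets of `B × C` that are closed under joins in each variable and do not distinguish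
`(b ⊓ φ a, c)` from `(b, c ⊓ ψ a)`. -/
structure IsBalanced (φ : FrameHom A B) (ψ : FrameHom A C) (U : LowerSet (B × C)) : Prop where
  sSup_left : ∀ (S : Set B) (c : C), (∀ b ∈ S, (b, c) ∈ U) → (sSup S, c) ∈ U
  sSup_right : ∀ (b : B) (S : Set C), (∀ c ∈ S, (b, c) ∈ U) → (b, sSup S) ∈ U
  balanced : ∀ (a : A) (b : B) (c : C), (b ⊓ φ a, c) ∈ U ↔ (b, c ⊓ ψ a) ∈ U

lemma mem_himp_iff {U V : LowerSet (B × C)} {x : B × C} :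
    x ∈ U ⇨ V ↔ ∀ y ≤ x, y ∈ U → y ∈ V := by
  rw [← LowerSet.Iic_le, le_himp_iff]
  constructor
  · intro h y hy hU
    exact h ⟨hy, hU⟩
  · rintro h y ⟨hy, hU⟩
    exact h y hy hU

/-- The underlying frame of the pushout `B ⊗_A C`, as a sublocale of the lower sets of `B × C`. -/
def tensor (φ : FrameHom A B) (ψ : FrameHom A C) : Sublocale (LowerSet (B × C)) where
  carrier := {U | IsBalanced φ ψ U}
  sInf_mem' 𝒮 h𝒮 := by
    refine ⟨fun S c h => ?_, fun b S h => ?_, fun a b c => ?_⟩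
    · simp only [LowerSet.mem_sInf_iff] at h ⊢
      exact fun U hU => (h𝒮 hU).sSup_left S c fun b hb => h b hb U hU
    · simp only [LowerSet.mem_sInf_iff] at h ⊢
      exact fun U hU => (h𝒮 hU).sSup_right b S fun c hc => h c hc U hU
    · simp only [LowerSet.mem_sInf_iff]
      exact forall₂_congr fun U hU => (h𝒮 hU).balanced a b c
  himp_mem' U V hV := by
    refine ⟨fun S c h => ?_, fun b S h => ?_, fun a b c => ?_⟩
    · rw [mem_himp_iff]
      rintro ⟨b', c'⟩ ⟨hb, hc⟩ hU
      have hb' : b' = sSup ((fun b => b' ⊓ b) '' S) := by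
        rw [sSup_image, ← inf_sSup_eq]
        exact (inf_eq_left.2 hb).symm
      rw [hb']
      refine hV.sSup_left _ _ ?_
      rintro _ ⟨b, hb, rfl⟩
      exact mem_himp_iff.1 (h b hb) _ ⟨inf_le_right, hc⟩ (U.lower (a := (b', c')) ⟨inf_le_left, le_rfl⟩ hU)
    · rw [mem_himp_iff]
      rintro ⟨b', c'⟩ ⟨hb, hc⟩ hU
      have hc' : c' = sSup ((fun c => c' ⊓ c) '' S) := by
        rw [sSup_image, ← inf_sSup_eq]
        exact (inf_eq_left.2 hc).symm
      rw [hc']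
      refine hV.sSup_right _ _ ?_
      rintro _ ⟨c, hc, rfl⟩
      exact mem_himp_iff.1 (h c hc) _ ⟨hb, inf_le_right⟩ (U.lower (a := (b', c')) ⟨le_rfl, inf_le_left⟩ hU)
    · simp only [mem_himp_iff]
      constructor
      · rintro h ⟨b', c'⟩ ⟨hb, hc⟩ hU
        have hc' : c' ⊓ ψ a = c' := inf_eq_left.2 (hc.trans inf_le_right)
        rw [← hc', ← hV.balanced]
        exact h _ ⟨inf_le_inf_right _ hb, hc.trans inf_le_left⟩
          (U.lower (a := (b', c')) ⟨inf_le_left, le_rfl⟩ hU)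
      · rintro h ⟨b', c'⟩ ⟨hb, hc⟩ hU
        have hb' : b' ⊓ φ a = b' := inf_eq_left.2 (hb.trans inf_le_right)
        rw [← hb', hV.balanced]
        exact h _ ⟨hb.trans inf_le_left, inf_le_inf_right _ hc⟩
          (U.lower (a := (b', c')) ⟨le_rfl, inf_le_left⟩ hU)

variable (φ : FrameHom A B) (ψ : FrameHom A C)

lemma restrict_le_iff {U : LowerSet (B × C)} {V : tensor φ ψ} :
    (tensor φ ψ).restrict U ≤ V ↔ U ≤ V.1 :=
  (tensor φ ψ).giRestrict.gc U V

/-- The element `b ⊗ c` of the pushout. -/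
def tmul (b : B) (c : C) : tensor φ ψ := (tensor φ ψ).restrict (LowerSet.Iic (b, c))

variable {φ ψ}

lemma tmul_le_iff {b : B} {c : C} {V : tensor φ ψ} : tmul φ ψ b c ≤ V ↔ (b, c) ∈ V.1 := by
  rw [tmul, restrict_le_iff, LowerSet.Iic_le]

lemma isBalanced (V : tensor φ ψ) : IsBalanced φ ψ V.1 := V.2

lemma tmul_inf (b b' : B) (c c' : C) :
    tmul φ ψ (b ⊓ b') (c ⊓ c') = tmul φ ψ b c ⊓ tmul φ ψ b' c' := by
  rw [tmul, tmul, tmul, ← map_inf]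
  refine congrArg _ (LowerSet.ext (Set.ext fun x => ?_))
  simp only [LowerSet.coe_Iic, LowerSet.coe_inf, Set.mem_inter_iff, Set.mem_Iic, Prod.le_def,
    le_inf_iff]
  tauto

lemma tmul_top : tmul φ ψ ⊤ ⊤ = ⊤ := by
  rw [tmul, ← map_top (tensor φ ψ).restrict]
  congr 1
  ext x
  simp [Prod.le_def]

lemma sSup_tmul (S : Set B) (c : C) :
    tmul φ ψ (sSup S) c = sSup ((fun b => tmul φ ψ b c) '' S) := by
  refine eq_of_forall_ge_iff fun V => ?_
  rw [tmul_le_iff, sSup_le_iff, Set.forall_mem_image]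
  simp only [tmul_le_iff]
  exact ⟨fun h b hb => V.1.lower (a := (sSup S, c)) ⟨le_sSup hb, le_rfl⟩ h, (isBalanced V).sSup_left S c⟩

lemma tmul_sSup (b : B) (S : Set C) :
    tmul φ ψ b (sSup S) = sSup ((fun c => tmul φ ψ b c) '' S) := by
  refine eq_of_forall_ge_iff fun V => ?_
  rw [tmul_le_iff, sSup_le_iff, Set.forall_mem_image]
  simp only [tmul_le_iff]
  exact ⟨fun h c hc => V.1.lower (a := (b, sSup S)) ⟨le_rfl, le_sSup hc⟩ h, (isBalanced V).sSup_right b S⟩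

lemma eq_sSup_tmul (V : tensor φ ψ) :
    V = sSup ((fun x : B × C => tmul φ ψ x.1 x.2) '' (V.1 : Set (B × C))) := by
  refine eq_of_forall_ge_iff fun W => ?_
  rw [sSup_le_iff, Set.forall_mem_image]
  simp only [tmul_le_iff]
  exact ⟨fun h x hx => h hx, fun h x hx => h hx⟩

variable (φ ψ)

/-- The left coprojection `b ↦ b ⊗ ⊤`. -/
def inl : FrameHom B (tensor φ ψ) where
  toFun b := tmul φ ψ b ⊤
  map_inf' b b' := by rw [← tmul_inf, inf_top_eq]
  map_top' := tmul_top
  map_sSup' S := sSup_tmul S ⊤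

/-- The right coprojection `c ↦ ⊤ ⊗ c`. -/
def inr : FrameHom C (tensor φ ψ) where
  toFun c := tmul φ ψ ⊤ c
  map_inf' c c' := by rw [← tmul_inf, inf_top_eq]
  map_top' := tmul_top
  map_sSup' S := tmul_sSup ⊤ S

lemma condition (a : A) : inl φ ψ (φ a) = inr φ ψ (ψ a) := by
  refine eq_of_forall_ge_iff fun V => ?_
  change tmul φ ψ (φ a) ⊤ ≤ V ↔ tmul φ ψ ⊤ (ψ a) ≤ V
  rw [tmul_le_iff, tmul_le_iff]
  simpa using (isBalanced V).balanced a ⊤ ⊤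

lemma inl_inf_inr (b : B) (c : C) : inl φ ψ b ⊓ inr φ ψ c = tmul φ ψ b c := by
  change tmul φ ψ b ⊤ ⊓ tmul φ ψ ⊤ c = _
  rw [← tmul_inf, inf_top_eq, top_inf_eq]

variable {φ ψ}

/-- The lower set of all `(b, c)` with `f b ⊓ g c ≤ d`. -/
def below (f : FrameHom B D) (g : FrameHom C D) (h : ∀ a, f (φ a) = g (ψ a)) (d : D) :
    tensor φ ψ :=
  ⟨⟨{x | f x.1 ⊓ g x.2 ≤ d}, fun x y hyx hx =>
      (inf_le_inf (OrderHomClass.mono f hyx.1) (OrderHomClass.mono g hyx.2)).trans hx⟩, by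
    refine ⟨fun S c hS => ?_, fun b S hS => ?_, fun a b c => ?_⟩
    · change f (sSup S) ⊓ g c ≤ d
      rw [map_sSup, sSup_inf_eq, iSup₂_le_iff]
      rintro _ ⟨b, hb, rfl⟩
      exact hS b hb
    · change f b ⊓ g (sSup S) ≤ d
      rw [map_sSup, inf_sSup_eq, iSup₂_le_iff]
      rintro _ ⟨c, hc, rfl⟩
      exact hS c hc
    · change f (b ⊓ φ a) ⊓ g c ≤ d ↔ f b ⊓ g (c ⊓ ψ a) ≤ d
      rw [map_inf, map_inf, h, inf_assoc, inf_comm (g c)]⟩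

/-- The value of the induced map out of the pushout. -/
def descFun (f : FrameHom B D) (g : FrameHom C D) (V : tensor φ ψ) : D :=
  ⨆ x : B × C, ⨆ _ : x ∈ V.1, f x.1 ⊓ g x.2

lemma descFun_gc (f : FrameHom B D) (g : FrameHom C D) (h : ∀ a, f (φ a) = g (ψ a)) :
    GaloisConnection (descFun (φ := φ) (ψ := ψ) f g) (below f g h) := fun V d => by
  rw [descFun, iSup₂_le_iff]
  exact ⟨fun H x hx => H x hx, fun H x hx => H hx⟩

lemma descFun_tmul (f : FrameHom B D) (g : FrameHom C D) (h : ∀ a, f (φ a) = g (ψ a))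
    (b : B) (c : C) : descFun f g (tmul φ ψ b c) = f b ⊓ g c := by
  refine eq_of_forall_ge_iff fun d => ?_
  rw [descFun_gc f g h, tmul_le_iff]
  rfl

/-- The map out of the pushout induced by a commutative square. -/
def desc (f : FrameHom B D) (g : FrameHom C D) (h : ∀ a, f (φ a) = g (ψ a)) :
    FrameHom (tensor φ ψ) D where
  toFun := descFun f g
  map_inf' V W := by
    refine le_antisymm ?_ ?_
    · exact (descFun_gc f g h).monotone_l.map_inf_le V W
    · simp only [descFun, iSup_inf_eq, inf_iSup_eq, iSup_le_iff]
      intro x hx y hy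
      refine le_trans ?_ (le_iSup₂ (x ⊓ y) ⟨V.1.lower inf_le_right ?_, W.1.lower inf_le_left ?_⟩)
      all_goals first
        | assumption
        | simp only [Prod.fst_inf, Prod.snd_inf, map_inf]
          exact le_of_eq (by ac_rfl)
  map_top' := by
    rw [← tmul_top, descFun_tmul f g h, map_top, map_top, inf_top_eq]
  map_sSup' S := by
    rw [(descFun_gc f g h).l_sSup, sSup_image]

lemma desc_inl (f : FrameHom B D) (g : FrameHom C D) (h : ∀ a, f (φ a) = g (ψ a)) (b : B) :
    desc f g h (inl φ ψ b) = f b :=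
  (descFun_tmul f g h b ⊤).trans (by rw [map_top, inf_top_eq])

lemma desc_inr (f : FrameHom B D) (g : FrameHom C D) (h : ∀ a, f (φ a) = g (ψ a)) (c : C) :
    desc f g h (inr φ ψ c) = g c :=
  (descFun_tmul f g h ⊤ c).trans (by rw [map_top, top_inf_eq])

lemma hom_ext {k l : FrameHom (tensor φ ψ) D} (h₁ : ∀ b, k (inl φ ψ b) = l (inl φ ψ b))
    (h₂ : ∀ c, k (inr φ ψ c) = l (inr φ ψ c)) (V : tensor φ ψ) : k V = l V := by
  rw [eq_sSup_tmul V, map_sSup, map_sSup, Set.image_image, Set.image_image]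
  congr 1
  refine Set.image_congr fun x _ => ?_
  rw [← inl_inf_inr, map_inf, map_inf, h₁, h₂]

end Construction

end FrmPushout

instance Frm.hasPushouts : HasPushouts Frm.{u} := by
  have key : ∀ {A B C : Frm.{u}} (φ : A ⟶ B) (ψ : A ⟶ C), HasColimit (span φ ψ) := by
    intro A B C φ ψ
    have hs (s : PushoutCocone φ ψ) (a : A) :
        s.inl.hom (φ.hom a) = s.inr.hom (ψ.hom a) :=
      congrArg (fun k => k.hom a) s.condition
    refine HasColimit.mk ⟨PushoutCocone.mk
      (Frm.ofHom (FrmPushout.inl φ.hom ψ.hom)) (Frm.ofHom (FrmPushout.inr φ.hom ψ.hom))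
      (Frm.ext fun a => FrmPushout.condition φ.hom ψ.hom a), ?_⟩
    refine PushoutCocone.IsColimit.mk _
      (fun s => Frm.ofHom (FrmPushout.desc s.inl.hom s.inr.hom (hs s)))
      (fun s => Frm.ext fun b => FrmPushout.desc_inl _ _ (hs s) b)
      (fun s => Frm.ext fun c => FrmPushout.desc_inr _ _ (hs s) c)
      (fun s k h₁ h₂ => Frm.ext fun V => ?_)
    refine FrmPushout.hom_ext (k := k.hom) (fun b => ?_) (fun c => ?_) V
    · exact (congrArg (fun k => k.hom b) h₁).trans (FrmPushout.desc_inl _ _ (hs s) b).symm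
    · exact (congrArg (fun k => k.hom c) h₂).trans (FrmPushout.desc_inr _ _ (hs s) c).symm
  exact @hasPushouts_of_hasColimit_span _ _ (fun {_ _ _ φ ψ} => key φ ψ)

instance Locale.hasPullbacks : HasPullbacks Locale.{u} :=
  inferInstanceAs (HasPullbacks Frm.{u}ᵒᵖ)

/-! ### Open maps and surjections of locales -/

namespace Locale

/-- The inverse image homomorphism `f^*` of a map of locales `f`. -/
def invImage {L M : Locale.{u}} (f : L ⟶ M) : FrameHom M L :=
  Frm.Hom.hom (Quiver.Hom.unop f)

/-- A map of locales `f` is open if `f^*` has a left adjoint `f_!` that satisfies the Frobenius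
condition. -/
def IsOpenMap {L M : Locale.{u}} (f : L ⟶ M) : Prop :=
  ∃ directImage : L → M, GaloisConnection directImage (invImage f) ∧
    ∀ (a : L) (b : M), directImage (a ⊓ invImage f b) = directImage a ⊓ b

/-- A map of locales is surjective if its inverse image homomorphism is injective. -/
def IsSurjective {L M : Locale.{u}} (f : L ⟶ M) : Prop :=
  Function.Injective (invImage f)

end Locale

/-! ### Internal groupoids -/

/-- A groupoid internal to a category with pullbacks.  The pair `(g, h)` of arrows is composable
if `r g = d h`, and then `g h = m (g, h)` has `d (g h) = d g` and `r (g h) = r h`. -/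
structure InternalGroupoid (𝒞 : Type v) [Category.{u} 𝒞] [HasPullbacks 𝒞] where
  /-- The object of objects. -/
  G₀ : 𝒞
  /-- The object of arrows. -/
  G₁ : 𝒞
  /-- The domain map. -/
  d : G₁ ⟶ G₀
  /-- The range map. -/
  r : G₁ ⟶ G₀
  /-- The unit map. -/
  u : G₀ ⟶ G₁
  /-- The inversion map. -/
  i : G₁ ⟶ G₁
  /-- The multiplication map. -/
  m : pullback r d ⟶ G₁
  u_d : u ≫ d = 𝟙 G₀
  u_r : u ≫ r = 𝟙 G₀
  m_d : m ≫ d = pullback.fst r d ≫ d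
  m_r : m ≫ r = pullback.snd r d ≫ r
  /-- `u (d g) g = g` -/
  unit_mul : pullback.lift (d ≫ u) (𝟙 G₁) (by simp [u_r]) ≫ m = 𝟙 G₁
  /-- `g u (r g) = g` -/
  mul_unit : pullback.lift (𝟙 G₁) (r ≫ u) (by simp [u_d]) ≫ m = 𝟙 G₁
  /-- `(g h) k = g (h k)`, on triples `(g, (h, k))` -/
  assoc :
    pullback.lift
        (pullback.lift (pullback.fst r (pullback.fst r d ≫ d))
          (pullback.snd r (pullback.fst r d ≫ d) ≫ pullback.fst r d)
          (by simp [pullback.condition]) ≫ m)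
        (pullback.snd r (pullback.fst r d ≫ d) ≫ pullback.snd r d)
        (by rw [Category.assoc, m_r, pullback.lift_snd_assoc, Category.assoc, Category.assoc,
          pullback.condition]) ≫ m =
      pullback.lift (pullback.fst r (pullback.fst r d ≫ d))
        (pullback.snd r (pullback.fst r d ≫ d) ≫ m)
        (by simp [m_d, pullback.condition]) ≫ m
  i_d : i ≫ d = r
  i_r : i ≫ r = d
  /-- `g g⁻¹ = u (d g)` -/
  mul_inv : pullback.lift (𝟙 G₁) i (by simp [i_d]) ≫ m = d ≫ u
  /-- `g⁻¹ g = u (r g)` -/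
  inv_mul : pullback.lift i (𝟙 G₁) (by simp [i_r]) ≫ m = r ≫ u

/-- A localic groupoid is a groupoid internal to locales. -/
abbrev LocalicGroupoid := InternalGroupoid Locale.{u}

namespace LocalicGroupoid

/-- A localic groupoid is open if its domain map is open. -/
def IsOpen (G : LocalicGroupoid.{u}) : Prop := Locale.IsOpenMap G.d

end LocalicGroupoid

/-! ### Actions and bundles -/

/-- A left `G`-locale: `g x` is defined if `r g = p x`, and then `p (g x) = d g`. -/
structure GLocale (G : LocalicGroupoid.{u}) where
  /-- The underlying locale. -/
  X : Locale.{u}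
  /-- The anchor map. -/
  p : X ⟶ G.G₀
  /-- The action, on the pullback `G₁ ×_{G₀} X`. -/
  act : pullback G.r p ⟶ X
  act_p : act ≫ p = pullback.fst G.r p ≫ G.d
  /-- `(g h) x = g (h x)`, on triples `(g, (h, x))` -/
  assoc :
    pullback.lift
        (pullback.lift (pullback.fst G.r (pullback.fst G.r p ≫ G.d))
          (pullback.snd G.r (pullback.fst G.r p ≫ G.d) ≫ pullback.fst G.r p)
          (by simp [pullback.condition]) ≫ G.m)
        (pullback.snd G.r (pullback.fst G.r p ≫ G.d) ≫ pullback.snd G.r p)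
        (by rw [Category.assoc, G.m_r, pullback.lift_snd_assoc, Category.assoc, Category.assoc,
          pullback.condition]) ≫ act =
      pullback.lift (pullback.fst G.r (pullback.fst G.r p ≫ G.d))
        (pullback.snd G.r (pullback.fst G.r p ≫ G.d) ≫ act)
        (by simp [act_p, pullback.condition]) ≫ act
  /-- `u (p x) x = x` -/
  unit_act : pullback.lift (p ≫ G.u) (𝟙 X) (by simp [G.u_r]) ≫ act = 𝟙 X

namespace GLocale

variable {G : LocalicGroupoid.{u}}

/-- A map `f : X ⟶ Y` of `G`-locales is equivariant if it is a map over `G₀` and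
`f (g x) = g (f x)`. -/
structure IsEquivariant (X Y : GLocale G) (f : X.X ⟶ Y.X) : Prop where
  comp_p : f ≫ Y.p = X.p
  act_comp :
    X.act ≫ f =
      pullback.lift (pullback.fst G.r X.p) (pullback.snd G.r X.p ≫ f)
        (by simp [comp_p, pullback.condition]) ≫ Y.act

end GLocale

/-- A `G`-bundle over `M`: a `G`-locale with an invariant map to `M`. -/
structure GBundle (G : LocalicGroupoid.{u}) (M : Locale.{u}) extends GLocale G where
  /-- The projection to the base. -/
  π : X ⟶ M
  act_π : act ≫ π = pullback.snd G.r p ≫ π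

namespace GBundle

variable {G : LocalicGroupoid.{u}} {M : Locale.{u}}

/-- The pairing map `(g, x) ↦ (g x, x)` from `G₁ ×_{G₀} X` to `X ×_M X`. -/
noncomputable def pairing (X : GBundle G M) : pullback G.r X.p ⟶ pullback X.π X.π :=
  pullback.lift X.act (pullback.snd G.r X.p) X.act_π

/-- A `G`-bundle is principal if its pairing map is an isomorphism and its projection is an open
surjection. -/
structure IsPrincipal (X : GBundle G M) : Prop where
  isIso_pairing : IsIso X.pairing
  isOpenMap_π : Locale.IsOpenMap X.π
  isSurjective_π : Locale.IsSurjective X.π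

/-- An isomorphism of locales `φ : X ≅ Y` is an isomorphism of `G`-bundles over `M` if it is
equivariant and commutes with the projections to `M`. -/
structure IsBundleIso (X Y : GBundle G M) (φ : X.X ≅ Y.X) : Prop where
  equivariant : X.toGLocale.IsEquivariant Y.toGLocale φ.hom
  comp_π : φ.hom ≫ Y.π = X.π

end GBundle

/-!
The base change of `X` is the fibre product `X ×_M M'`, with `G` acting on the first factor. Open
surjections of locales are stable under pullback: if `l` is the direct image of an open map, the
direct image along its pullback sends `b ⊗ c` to `ψ (l b) ⊓ c`, which is the Frobenius condition and
the Beck–Chevalley condition at once. The pairing map is an isomorphism exactly when the action and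
the projection `G₁ ×_{G₀} X ⟶ X` present `X ×_M X`, so pasting pullback squares transfers this
property from `X` to its base change.

For the universal property, let `φ : X ⟶ Y` be an equivariant map of principal bundles over `M`.
Both `X ×_M X` and `X ×_M Y` are identified with `G₁ ×_{G₀} X`, which makes `X ×_M φ` an
isomorphism. It is the pullback of `φ` along the open surjection `X ×_M Y ⟶ Y`, and isomorphisms
descend along open surjections by the Beck–Chevalley condition.
-/

section FrobeniusAdjoint

variable {A B P F : Type*} [SemilatticeInf A] [SemilatticeInf B] [SemilatticeInf P]

/-- `l` is a left adjoint of `u` that satisfies Frobenius reciprocity. A map of locales is open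
exactly when its inverse image homomorphism has such an adjoint, its direct image. -/
structure IsFrobeniusAdjoint (l : B → A) (u : A → B) : Prop where
  gc : GaloisConnection l u
  l_inf_u : ∀ (b : B) (a : A), l (b ⊓ u a) = l b ⊓ a

lemma IsFrobeniusAdjoint.comp_of_injective {l : B → A} {u : A → B} (hl : IsFrobeniusAdjoint l u)
    [FunLike F P B] [InfHomClass F P B] {θ : F} (hθ : Function.Injective θ) {v : A → P}
    (hv : ∀ a, θ (v a) = u a) : IsFrobeniusAdjoint (l ∘ θ) v where
  gc x a := by
    rw [Function.comp_apply, hl.gc, ← hv]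
    exact (orderEmbeddingOfInjective θ hθ).le_iff_le
  l_inf_u x a := by rw [Function.comp_apply, map_inf, hv, hl.l_inf_u, Function.comp_apply]

end FrobeniusAdjoint

namespace FrmPushout

section DirectImage

variable {A B C : Type u} [Order.Frame A] [Order.Frame B] [Order.Frame C]
  {φ : FrameHom A B} {ψ : FrameHom A C} {l : B → A}

lemma tmul_inf_map (a : A) (b : B) (c : C) :
    tmul φ ψ (b ⊓ φ a) c = tmul φ ψ b (c ⊓ ψ a) :=
  eq_of_forall_ge_iff fun V => by
    rw [tmul_le_iff, tmul_le_iff]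
    exact (isBalanced V).balanced a b c

/-- The join of all `b ⊗ c` with `ψ (l b) ⊓ c ≤ c₀`, given by its underlying lower set. It is the
value at `c₀` of the right adjoint of `directImage`. -/
def directImageBelow (hl : IsFrobeniusAdjoint l φ) (c₀ : C) : tensor φ ψ :=
  ⟨⟨{x | ψ (l x.1) ⊓ x.2 ≤ c₀}, fun _ _ hyx hx =>
      (inf_le_inf (OrderHomClass.mono ψ (hl.gc.monotone_l hyx.1)) hyx.2).trans hx⟩, by
    refine ⟨fun S c hS => ?_, fun b S hS => ?_, fun a b c => ?_⟩
    · change ψ (l (sSup S)) ⊓ c ≤ c₀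
      rw [hl.gc.l_sSup, ← sSup_image, map_sSup, sSup_inf_eq, iSup₂_le_iff]
      rintro _ ⟨_, ⟨b, hb, rfl⟩, rfl⟩
      exact hS b hb
    · change ψ (l b) ⊓ sSup S ≤ c₀
      rw [inf_sSup_eq, iSup₂_le_iff]
      exact hS
    · change ψ (l (b ⊓ φ a)) ⊓ c ≤ c₀ ↔ ψ (l b) ⊓ (c ⊓ ψ a) ≤ c₀
      rw [hl.l_inf_u, map_inf, inf_assoc, inf_comm c]⟩

lemma inr_eq_directImageBelow (hl : IsFrobeniusAdjoint l φ) (c₀ : C) :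
    inr φ ψ c₀ = directImageBelow hl c₀ := by
  refine le_antisymm (tmul_le_iff.2 (inf_le_right : ψ (l ⊤) ⊓ c₀ ≤ c₀)) fun ⟨b, c⟩ hbc => ?_
  have hmem : (b, c ⊓ ψ (l b)) ∈ (inr φ ψ c₀).1 :=
    (inr φ ψ c₀).1.lower (a := (⊤, c₀)) ⟨le_top, inf_comm c _ ▸ hbc⟩ (tmul_le_iff.1 le_rfl)
  rwa [← tmul_le_iff, ← tmul_inf_map, inf_eq_left.2 (hl.gc.le_u_l b), tmul_le_iff] at hmem

/-- The direct image along the right coprojection, induced by a direct image `l` along `φ`: the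
join-preserving map with `b ⊗ c ↦ ψ (l b) ⊓ c`. -/
def directImage (φ : FrameHom A B) (ψ : FrameHom A C) (l : B → A) (V : tensor φ ψ) : C :=
  ⨆ x : B × C, ⨆ _ : x ∈ V.1, ψ (l x.1) ⊓ x.2

lemma gc_directImage (hl : IsFrobeniusAdjoint l φ) :
    GaloisConnection (directImage φ ψ l) (inr φ ψ) := fun V c => by
  rw [directImage, iSup₂_le_iff, inr_eq_directImageBelow hl]
  exact ⟨fun h x hx => h x hx, fun h x hx => h hx⟩

lemma directImage_tmul (hl : IsFrobeniusAdjoint l φ) (b : B) (c : C) :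
    directImage φ ψ l (tmul φ ψ b c) = ψ (l b) ⊓ c :=
  eq_of_forall_ge_iff fun c₀ => by
    rw [gc_directImage hl, tmul_le_iff, inr_eq_directImageBelow hl]
    rfl

lemma directImage_inl (hl : IsFrobeniusAdjoint l φ) (b : B) :
    directImage φ ψ l (inl φ ψ b) = ψ (l b) :=
  (directImage_tmul hl b ⊤).trans (inf_top_eq _)

lemma isFrobeniusAdjoint_directImage (hl : IsFrobeniusAdjoint l φ) :
    IsFrobeniusAdjoint (directImage φ ψ l) (inr φ ψ) where
  gc := gc_directImage hl
  l_inf_u V c := by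
    have hgc := gc_directImage (ψ := ψ) hl
    refine le_antisymm (le_inf (hgc.monotone_l inf_le_left) (hgc.l_le inf_le_right)) ?_
    rw [directImage, iSup₂_inf_eq, iSup₂_le_iff]
    intro x hx
    have hle : tmul φ ψ x.1 (x.2 ⊓ c) ≤ V ⊓ inr φ ψ c := by
      rw [← inf_top_eq x.1, tmul_inf]
      exact inf_le_inf_right _ (tmul_le_iff.2 hx)
    calc ψ (l x.1) ⊓ x.2 ⊓ c = directImage φ ψ l (tmul φ ψ x.1 (x.2 ⊓ c)) := by
          rw [directImage_tmul hl, inf_assoc]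
      _ ≤ directImage φ ψ l (V ⊓ inr φ ψ c) := hgc.monotone_l hle

end DirectImage

lemma isPushout_tensor {A B C : Frm.{u}} (φ : A ⟶ B) (ψ : A ⟶ C) :
    IsPushout φ ψ (Frm.ofHom (inl φ.hom ψ.hom)) (Frm.ofHom (inr φ.hom ψ.hom)) := by
  have hs (s : PushoutCocone φ ψ) (a : A) : s.inl.hom (φ.hom a) = s.inr.hom (ψ.hom a) :=
    ConcreteCategory.congr_hom s.condition a
  refine ⟨⟨Frm.ext (condition φ.hom ψ.hom)⟩, ⟨PushoutCocone.IsColimit.mk _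
    (fun s => Frm.ofHom (desc s.inl.hom s.inr.hom (hs s)))
    (fun s => Frm.ext (desc_inl _ _ (hs s))) (fun s => Frm.ext (desc_inr _ _ (hs s)))
    fun s k hinl hinr => Frm.ext (hom_ext (k := k.hom) (fun b => ?_) fun c => ?_)⟩⟩
  · exact (ConcreteCategory.congr_hom hinl b).trans (desc_inl _ _ (hs s) b).symm
  · exact (ConcreteCategory.congr_hom hinr c).trans (desc_inr _ _ (hs s) c).symm

end FrmPushout

namespace LocaleMap

open Locale (invImage IsSurjective)

variable {L M N : Locale.{u}}

lemma invImage_comp (f : L ⟶ M) (g : M ⟶ N) (x : N) :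
    invImage (f ≫ g) x = invImage f (invImage g x) := rfl

lemma isSurjective_of_isIso (f : L ⟶ M) [IsIso f] : IsSurjective f :=
  Function.LeftInverse.injective (g := invImage (inv f)) fun x => by
    rw [← invImage_comp, IsIso.inv_hom_id]
    rfl

lemma isIso_of_bijective_invImage (f : L ⟶ M) (hf : Function.Bijective (invImage f)) :
    IsIso f := by
  let o : M ≃o L := RelIso.ofSurjective (orderEmbeddingOfInjective (invImage f) hf.1) hf.2
  have : IsIso (Quiver.Hom.unop f) := (Frm.Iso.mk (α := M.unop) (β := L.unop) o).isIso_hom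
  exact (isIso_unop_iff f).1 this

lemma isOpenMap_iff {f : L ⟶ M} :
    Locale.IsOpenMap f ↔ ∃ l, IsFrobeniusAdjoint l (invImage f) :=
  exists_congr fun _ => ⟨fun h => ⟨h.1, h.2⟩, fun h => ⟨h.1, h.2⟩⟩

variable {P E B : Locale.{u}} {fst : P ⟶ E} {snd : P ⟶ L} {e : E ⟶ B} {g : L ⟶ B}

lemma exists_injective_tensor_of_isPullback (h : IsPullback fst snd e g) :
    ∃ θ : FrameHom P (FrmPushout.tensor (invImage e) (invImage g)), Function.Injective θ ∧
      (∀ a, θ (invImage fst a) = FrmPushout.inl (invImage e) (invImage g) a) ∧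
      ∀ b, θ (invImage snd b) = FrmPushout.inr (invImage e) (invImage g) b := by
  have hP : IsPushout e.unop g.unop fst.unop snd.unop := h.unop.flip
  have hT := FrmPushout.isPushout_tensor e.unop g.unop
  let θ := hP.isoIsPushout _ _ hT
  exact ⟨θ.hom.hom, (ConcreteCategory.bijective_of_isIso θ.hom).1,
    ConcreteCategory.congr_hom (hP.inl_isoIsPushout_hom _ _ hT),
    ConcreteCategory.congr_hom (hP.inr_isoIsPushout_hom _ _ hT)⟩

theorem beckChevalley (h : IsPullback fst snd e g) {l : E → B}
    (hl : IsFrobeniusAdjoint l (invImage e)) :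
    ∃ k : P → L, IsFrobeniusAdjoint k (invImage snd) ∧
      ∀ a, k (invImage fst a) = invImage g (l a) := by
  obtain ⟨θ, hθ, hfst, hsnd⟩ := exists_injective_tensor_of_isPullback h
  refine ⟨_, (FrmPushout.isFrobeniusAdjoint_directImage hl).comp_of_injective hθ hsnd,
    fun a => ?_⟩
  rw [Function.comp_apply, hfst, FrmPushout.directImage_inl hl]

theorem isOpenMap_of_isPullback (h : IsPullback fst snd e g) (he : Locale.IsOpenMap e) :
    Locale.IsOpenMap snd := by
  obtain ⟨l, hl⟩ := isOpenMap_iff.1 he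
  obtain ⟨k, hk, -⟩ := beckChevalley h hl
  exact isOpenMap_iff.2 ⟨k, hk⟩

theorem isSurjective_of_isPullback (h : IsPullback fst snd e g) (he : Locale.IsOpenMap e)
    (hs : IsSurjective e) : IsSurjective snd := by
  obtain ⟨l, hl⟩ := isOpenMap_iff.1 he
  obtain ⟨k, hk, bc⟩ := beckChevalley h hl
  have hl_top : l ⊤ = ⊤ := by
    rw [← map_top (invImage e)]
    exact hs (hl.gc.u_l_u_eq_u ⊤)
  have hk_top : k ⊤ = ⊤ := by
    rw [← map_top (invImage fst), bc, hl_top, map_top]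
  refine Function.LeftInverse.injective (g := k) fun b => ?_
  rw [← top_inf_eq (invImage snd b), hk.l_inf_u, hk_top, top_inf_eq]

theorem isIso_of_isPullback_of_isIso_fst (h : IsPullback fst snd e g) (he : Locale.IsOpenMap e)
    (hs : IsSurjective e) [IsIso fst] : IsIso g := by
  have hsnd := isSurjective_of_isPullback h he hs
  obtain ⟨l, hl⟩ := isOpenMap_iff.1 he
  obtain ⟨k, hk, bc⟩ := beckChevalley h hl
  have h_comp : IsSurjective (snd ≫ g) := by
    rw [← h.w]
    exact (isSurjective_of_isIso fst).comp hs
  refine isIso_of_bijective_invImage g ⟨Function.Injective.of_comp (f := invImage snd) h_comp,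
    fun w => ⟨l (invImage (inv fst) (invImage snd w)), hsnd ?_⟩⟩
  rw [← bc, ← invImage_comp fst, IsIso.hom_inv_id]
  exact hk.gc.u_l_u_eq_u w

end LocaleMap

namespace GLocale

variable {G : LocalicGroupoid.{u}} {S T : Locale.{u}} (X : GLocale G)

/-- The action on generalized elements: `g x` for an arrow `g` and a point `x` at stage `T`. -/
noncomputable def smul (g : T ⟶ G.G₁) (x : T ⟶ X.X) (h : g ≫ G.r = x ≫ X.p) : T ⟶ X.X :=
  pullback.lift g x h ≫ X.act

lemma smul_p (g : T ⟶ G.G₁) (x : T ⟶ X.X) (h : g ≫ G.r = x ≫ X.p) :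
    X.smul g x h ≫ X.p = g ≫ G.d := by
  rw [smul, Category.assoc, X.act_p, pullback.lift_fst_assoc]

lemma comp_act (k : T ⟶ pullback G.r X.p) :
    k ≫ X.act = X.smul (k ≫ pullback.fst G.r X.p) (k ≫ pullback.snd G.r X.p)
      (by simp only [Category.assoc, pullback.condition]) := by
  rw [smul]
  congr 1
  apply pullback.hom_ext <;> simp only [pullback.lift_fst, pullback.lift_snd]

lemma comp_smul (k : S ⟶ T) (g : T ⟶ G.G₁) (x : T ⟶ X.X) (h : g ≫ G.r = x ≫ X.p) :
    k ≫ X.smul g x h = X.smul (k ≫ g) (k ≫ x) (by simp only [Category.assoc, h]) := by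
  rw [smul, ← Category.assoc, comp_act]
  simp only [Category.assoc, pullback.lift_fst, pullback.lift_snd]

lemma mul_smul (g h : T ⟶ G.G₁) (x : T ⟶ X.X) (hgh : g ≫ G.r = h ≫ G.d)
    (hx : h ≫ G.r = x ≫ X.p) :
    X.smul (pullback.lift g h hgh ≫ G.m) x
        (by rw [Category.assoc, G.m_r, pullback.lift_snd_assoc, hx]) =
      X.smul g (X.smul h x hx) (by rw [smul_p, hgh]) := by
  have key := congrArg (pullback.lift (f := G.r) (g := pullback.fst G.r X.p ≫ G.d)
    g (pullback.lift h x hx) (by rw [pullback.lift_fst_assoc, hgh]) ≫ ·) X.assoc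
  simp only [comp_act, pullback.lift_fst, pullback.lift_snd,
    pullback.lift_snd_assoc, comp_smul] at key
  have lift_comp : pullback.lift g (pullback.lift h x hx)
        (by rw [pullback.lift_fst_assoc, hgh]) ≫
      pullback.lift (pullback.fst G.r (pullback.fst G.r X.p ≫ G.d))
        (pullback.snd G.r (pullback.fst G.r X.p ≫ G.d) ≫ pullback.fst G.r X.p)
        (by rw [Category.assoc, pullback.condition]) = pullback.lift g h hgh := by
    apply pullback.hom_ext <;>
      simp only [Category.assoc, pullback.lift_fst, pullback.lift_snd, pullback.lift_snd_assoc]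
  simpa only [reassoc_of% lift_comp] using key

lemma unit_smul (x : T ⟶ X.X) :
    X.smul (x ≫ X.p ≫ G.u) x (by simp only [Category.assoc, G.u_r, Category.comp_id]) = x := by
  have key := congrArg (x ≫ ·) X.unit_act
  simpa only [comp_act, comp_smul, pullback.lift_fst, pullback.lift_snd,
    Category.comp_id] using key

variable {X} {Y : GLocale G} {f : X.X ⟶ Y.X}

lemma IsEquivariant.smul_comp (hf : X.IsEquivariant Y f) (g : T ⟶ G.G₁) (x : T ⟶ X.X)
    (h : g ≫ G.r = x ≫ X.p) :
    X.smul g x h ≫ f = Y.smul g (x ≫ f) (by rw [Category.assoc, hf.comp_p, h]) := by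
  rw [smul, Category.assoc, hf.act_comp]
  simp only [comp_act, comp_smul, pullback.lift_fst, pullback.lift_snd, pullback.lift_snd_assoc]

lemma isPullback_lift_snd (hf : f ≫ Y.p = X.p) :
    IsPullback
      (pullback.lift (pullback.fst G.r X.p) (pullback.snd G.r X.p ≫ f)
        (by rw [Category.assoc, hf, pullback.condition]) : pullback G.r X.p ⟶ pullback G.r Y.p)
      (pullback.snd G.r X.p) (pullback.snd G.r Y.p) f := by
  refine IsPullback.flip (IsPullback.of_bot (v₂₁ := pullback.fst G.r Y.p) (v₂₂ := Y.p)
    (h₃₁ := G.r) ?_ (pullback.lift_snd _ _ _).symm (IsPullback.of_hasPullback G.r Y.p).flip)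
  rw [pullback.lift_fst, hf]
  exact (IsPullback.of_hasPullback G.r X.p).flip

end GLocale

namespace GBundle

variable {G : LocalicGroupoid.{u}} {M M' : Locale.{u}}

lemma smul_π (X : GBundle G M) {T : Locale.{u}} (g : T ⟶ G.G₁) (x : T ⟶ X.X)
    (h : g ≫ G.r = x ≫ X.p) : X.smul g x h ≫ X.π = x ≫ X.π := by
  rw [GLocale.smul, Category.assoc, X.act_π, pullback.lift_snd_assoc]

lemma isIso_pairing_iff_isPullback {X : GBundle G M} :
    IsIso X.pairing ↔ IsPullback X.act (pullback.snd G.r X.p) X.π X.π := by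
  refine ⟨fun _ => IsPullback.of_iso_pullback ⟨X.act_π⟩ (asIso X.pairing)
    (pullback.lift_fst _ _ _) (pullback.lift_snd _ _ _), fun h => ?_⟩
  have : X.pairing = h.isoPullback.hom := by
    apply pullback.hom_ext
    · exact (pullback.lift_fst _ _ _).trans h.isoPullback_hom_fst.symm
    · exact (pullback.lift_snd _ _ _).trans h.isoPullback_hom_snd.symm
  rw [this]
  infer_instance

theorem isIso_of_isEquivariant {X Y : GBundle G M} (hX : X.IsPrincipal) (hY : IsIso Y.pairing)
    {φ : X.X ⟶ Y.X} (hφ : X.IsEquivariant Y.toGLocale φ) (hπ : φ ≫ Y.π = X.π) : IsIso φ := by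
  have hX_pb := isIso_pairing_iff_isPullback.1 hX.isIso_pairing
  -- `G₁ ×_{G₀} X ≅ Y ×_M X`, the pullback along `φ` of the pairing of `Y`.
  have hXY : IsPullback (pullback.snd G.r X.p) (X.act ≫ φ) X.π Y.π := by
    have h := (GLocale.isPullback_lift_snd hφ.comp_p).paste_horiz
      (isIso_pairing_iff_isPullback.1 hY)
    rw [← hφ.act_comp, hπ] at h
    exact h.flip
  have h_id : IsPullback (𝟙 (pullback G.r X.p)) X.act (X.act ≫ φ) φ := by
    refine IsPullback.of_right ?_ (Category.id_comp _) hXY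
    rw [Category.id_comp, hπ]
    exact hX_pb.flip
  exact LocaleMap.isIso_of_isPullback_of_isIso_fst h_id
    (LocaleMap.isOpenMap_of_isPullback hXY hX.isOpenMap_π)
    (LocaleMap.isSurjective_of_isPullback hXY hX.isOpenMap_π hX.isSurjective_π)

section Pullback

variable {X : GBundle G M} {Y X' : GBundle G M'} {f : M' ⟶ M} {fY : Y.X ⟶ X.X}

lemma isIso_pairing_of_isPullback (hfY : Y.IsEquivariant X.toGLocale fY)
    (hP : IsPullback fY Y.π X.π f) (hX : IsIso X.pairing) : IsIso Y.pairing := by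
  have h := (GLocale.isPullback_lift_snd hfY.comp_p).paste_horiz
    (isIso_pairing_iff_isPullback.1 hX)
  rw [← hfY.act_comp, hP.w] at h
  exact isIso_pairing_iff_isPullback.2 (h.of_right Y.act_π hP)

theorem IsPrincipal.of_isPullback (hX : X.IsPrincipal) (hfY : Y.IsEquivariant X.toGLocale fY)
    (hP : IsPullback fY Y.π X.π f) : Y.IsPrincipal where
  isIso_pairing := isIso_pairing_of_isPullback hfY hP hX.isIso_pairing
  isOpenMap_π := LocaleMap.isOpenMap_of_isPullback hP hX.isOpenMap_π
  isSurjective_π := LocaleMap.isSurjective_of_isPullback hP hX.isOpenMap_π hX.isSurjective_π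

lemma isEquivariant_of_comp (hfY : Y.IsEquivariant X.toGLocale fY)
    (hP : IsPullback fY Y.π X.π f) {φ : X'.X ⟶ Y.X}
    (hφ : X'.IsEquivariant X.toGLocale (φ ≫ fY)) (hπ : φ ≫ Y.π = X'.π) :
    X'.IsEquivariant Y.toGLocale φ where
  comp_p := by rw [← hφ.comp_p, Category.assoc, hfY.comp_p]
  act_comp := by
    change _ = Y.smul _ _ _
    apply hP.hom_ext
    · rw [Category.assoc, hφ.act_comp, hfY.smul_comp, GLocale.smul]
      simp only [Category.assoc]
    · rw [smul_π, Category.assoc, Category.assoc, hπ, X'.act_π]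

theorem existsUnique_isBundleIso (hX : IsIso X.pairing) (hfY : Y.IsEquivariant X.toGLocale fY)
    (hP : IsPullback fY Y.π X.π f) (hX' : X'.IsPrincipal) {f' : X'.X ⟶ X.X}
    (hf' : X'.IsEquivariant X.toGLocale f') (hw : f' ≫ X.π = X'.π ≫ f) :
    ∃! φ : X'.X ≅ Y.X, X'.IsBundleIso Y φ ∧ φ.hom ≫ fY = f' := by
  obtain ⟨φ, rfl, hφπ⟩ := hP.exists_lift f' X'.π hw
  have hφ := isEquivariant_of_comp hfY hP hf' hφπ
  have := isIso_of_isEquivariant hX' (isIso_pairing_of_isPullback hfY hP hX) hφ hφπ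
  refine ⟨asIso φ, ⟨⟨hφ, hφπ⟩, rfl⟩, fun χ ⟨hχ, hχfY⟩ => ?_⟩
  exact Iso.ext (hP.hom_ext hχfY (hχ.comp_π.trans hφπ.symm))

end Pullback

/-- The base change `X ×_M M'` of a `G`-bundle along a map of bases, with `G` acting on the first
factor. -/
noncomputable def baseChange (X : GBundle G M) (f : M' ⟶ M) : GBundle G M' where
  X := pullback X.π f
  p := pullback.fst X.π f ≫ X.p
  act := pullback.lift
    (X.smul (pullback.fst _ _) (pullback.snd _ _ ≫ pullback.fst X.π f)
      (by rw [pullback.condition, Category.assoc]))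
    (pullback.snd _ _ ≫ pullback.snd X.π f)
    (by rw [smul_π, Category.assoc, Category.assoc, pullback.condition])
  act_p := by rw [pullback.lift_fst_assoc, GLocale.smul_p]
  assoc := by
    apply pullback.hom_ext
    · simp only [Category.assoc, pullback.lift_fst, GLocale.comp_smul, pullback.lift_snd_assoc]
      exact X.mul_smul _ _ _ _ _
    · simp only [Category.assoc, pullback.lift_snd, pullback.lift_snd_assoc]
  unit_act := by
    apply pullback.hom_ext
    · simp only [Category.assoc, pullback.lift_fst, GLocale.comp_smul, pullback.lift_snd_assoc,
        Category.id_comp]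
      exact X.unit_smul _
    · simp only [Category.assoc, pullback.lift_snd, pullback.lift_snd_assoc]
  π := pullback.snd X.π f
  act_π := pullback.lift_snd _ _ _

lemma isPullback_baseChange (X : GBundle G M) (f : M' ⟶ M) :
    IsPullback (pullback.fst X.π f) (X.baseChange f).π X.π f :=
  IsPullback.of_hasPullback X.π f

lemma isEquivariant_baseChange_fst (X : GBundle G M) (f : M' ⟶ M) :
    (X.baseChange f).IsEquivariant X.toGLocale (pullback.fst X.π f) where
  comp_p := rfl
  act_comp := pullback.lift_fst _ _ _

end GBundle

theorem mainTheorem6_general (G : LocalicGroupoid.{u}) {M M' : Locale.{u}}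
    (X : GBundle G M) (hX : X.IsPrincipal) (f : M' ⟶ M) :
    ∃ (Y : GBundle G M') (fY : Y.X ⟶ X.X),
      Y.IsPrincipal ∧
      Y.toGLocale.IsEquivariant X.toGLocale fY ∧
      IsPullback fY Y.π X.π f ∧
      ∀ (X' : GBundle G M') (f' : X'.X ⟶ X.X), X'.IsPrincipal →
        X'.toGLocale.IsEquivariant X.toGLocale f' → f' ≫ X.π = X'.π ≫ f →
        ∃! φ : X'.X ≅ Y.X, X'.IsBundleIso Y φ ∧ φ.hom ≫ fY = f' := by
  have hP := X.isPullback_baseChange f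
  have hfst := X.isEquivariant_baseChange_fst f
  exact ⟨X.baseChange f, pullback.fst X.π f, hX.of_isPullback hfst hP, hfst, hP,
    fun _ _ hX' hf' hw => GBundle.existsUnique_isBundleIso hX.isIso_pairing hfst hP hX' hf' hw⟩

theorem mainTheorem6 (G : LocalicGroupoid.{u}) (hG : G.IsOpen) {M M' : Locale.{u}}
    (X : GBundle G M) (hX : X.IsPrincipal) (f : M' ⟶ M) :
    ∃ (Y : GBundle G M') (fY : Y.X ⟶ X.X),
      Y.IsPrincipal ∧
      Y.toGLocale.IsEquivariant X.toGLocale fY ∧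
      IsPullback fY Y.π X.π f ∧
      ∀ (X' : GBundle G M') (f' : X'.X ⟶ X.X), X'.IsPrincipal →
        X'.toGLocale.IsEquivariant X.toGLocale f' → f' ≫ X.π = X'.π ≫ f →
        ∃! φ : X'.X ≅ Y.X, X'.IsBundleIso Y φ ∧ φ.hom ≫ fY = f' := by
  exact mainTheorem6_general G X hX f
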